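/- Let $d,l\ge 1$, $K=l^d\ge 2$, $n\ge 1$. Let $\mathcal N_K=(\Omega_k)_{k\le K}$ be the partition of $[0,1]^d$ into $K$ hyper-cubes of side length $1/l$, so that each stratum has Lebesgue measure $w_k=1/K$. An *environment* consists of functions $f,s\in L^2([0,1]^d)$ with $s\ge 0$, and of a noise distribution $\nu_x$ on $\mathbb R$ with mean $0$ and variance $1$ for every $x\in[0,1]^d$ (measurable in $x$). A query at $x$ returns $f(x)+s(x)\varepsilon$ with a fresh independent $\varepsilon\sim\nu_x$. An *online stratified-sampling algorithm* chooses, in each round $t=1,\dots,n$, the index $k_t$ of a stratum, possibly at random, with a law that depends on everything recorded in the previous rounds (chosen strata, query points, observations); then a point drawn uniformly from $\Omega_{k_t}$ is queried. Let $\sigma_k^2$ be the variance of an observation at a uniformly drawn point of $\Omega_k$, and $T_{k,n}=\sum_{t\le n}\mathbf 1\{k_t=k\}$. The pseudo-regret is the pseudo-risk minus the risk of the optimal oracle allocation, $$R_{n,\mathcal N_K}=\sum_{k\le K}\frac{w_k^2\sigma_k^2}{T_{k,n}}-\frac1n\Big(\sum_{k\le K}w_k\sigma_k\Big)^2\in(-\infty,+\infty],$$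 where a stratum with $T_{k,n}=0$ contributes $+\infty$ to the first sum if $\sigma_k>0$ and $0$ if $\sigma_k=0$. **Theorem.** There is a numerical constant $C>0$ such that for all $d,l,K,n$ as above $$\inf_{\mathcal A}\ \sup_{E}\ \mathbb E\big[R_{n,\mathcal N_K}(\mathcal A)\big]\ \ge\ C\,\frac{K^{1/3}}{n^{4/3}},$$ where the infimum is over all online stratified-sampling algorithms on $\mathcal N_K$ and the supremum is over all environments. The same bound holds, with the same $C$, when the supremum is restricted to the environments all of whose observations take values in $\{0,1\}$ (Bernoulli observations). -/

import Mathlib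

open MeasureTheory ProbabilityTheory

noncomputable section

namespace StratMC

/-- The ambient space of the domain `[0,1]^d`; it carries Lebesgue measure `volume`. -/
abbrev Point (d : ℕ) := Fin d → ℝ

/-- The unit cube `[0,1]^d`. -/
def cube (d : ℕ) : Set (Point d) := Set.Icc 0 1

/-- The hyper-cubic partition of `[0,1]^d` into `K = l ^ d` strata of side length `1 / l`: the
stratum of index `k` is `∏ i, [k i / l, (k i + 1) / l)`, where the last interval of each axis also
contains its right end point `1`. -/
def gridStratum (d l : ℕ) (k : Fin d → Fin l) : Set (Point d) :=
  {x | ∀ i, ((k i : ℕ) : ℝ) / l ≤ x i ∧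
    (x i < (((k i : ℕ) : ℝ) + 1) / l ∨ ((k i : ℕ) + 1 = l ∧ x i = 1))}

/-- An environment: a function `f`, a noise level `s` and, for every point `x`, a noise
distribution `noise x` of mean `0` and variance `1`. A query at `x` returns `f x + s x * ε` with a
fresh `ε` drawn from `noise x`. Only the values on the unit cube matter. -/
structure Environment (d : ℕ) where
  f : Point d → ℝ
  s : Point d → ℝ
  noise : Kernel (Point d) ℝ
  measurable_f : Measurable f
  measurable_s : Measurable s
  memLp_f : MemLp f 2 (volume.restrict (cube d))
  memLp_s : MemLp s 2 (volume.restrict (cube d))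
  s_nonneg : ∀ x ∈ cube d, 0 ≤ s x
  isMarkov_noise : IsMarkovKernel noise
  noise_mean : ∀ x ∈ cube d, ∫ ε, ε ∂(noise x) = 0
  noise_variance : ∀ x ∈ cube d, ∫ ε, ε ^ 2 ∂(noise x) = 1

attribute [instance] Environment.isMarkov_noise

namespace Environment

variable {d : ℕ} (E : Environment d)

/-- The law of the observation `f x + s x * ε` when the function is queried at `x`. -/
def observe : Kernel (Point d) ℝ :=
  (Kernel.id ×ₖ E.noise).map (fun p : Point d × ℝ => E.f p.1 + E.s p.1 * p.2)

/-- All observations take their values in `{0, 1}`. Equivalently, every observation is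
Bernoulli distributed. -/
def IsBinary : Prop :=
  ∀ x ∈ cube d, ∀ᵐ ε ∂(E.noise x), E.f x + E.s x * ε = 0 ∨ E.f x + E.s x * ε = 1

variable {ι : Type} (Ω : ι → Set (Point d))

/-- The joint law of the query point and of the observation when one samples uniformly in the
stratum `Ω k`. -/
def sampleLaw [Countable ι] [MeasurableSpace ι] [MeasurableSingletonClass ι] :
    Kernel ι (Point d × ℝ) :=
  Kernel.ofFunOfCountable fun k => (cond volume (Ω k)) ⊗ₘ E.observe

/-- The measure `w_k` of a stratum. -/
def weight (k : ι) : ℝ := volume.real (Ω k)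

/-- The mean `μ_k` of a stratum. -/
def stratumMean (k : ι) : ℝ := (weight Ω k)⁻¹ * ∫ x in Ω k, E.f x

/-- The variance `σ_k ^ 2` of a stratum. -/
def stratumVar (k : ι) : ℝ :=
  (weight Ω k)⁻¹ *
    ∫ x in Ω k, ∫ ε, (E.f x + E.s x * ε - E.stratumMean Ω k) ^ 2 ∂(E.noise x)

/-- The pseudo-risk `(∑ k, w_k * σ_k) ^ 2 / n` of the optimal oracle allocation of `n` samples. -/
def oracleRisk [Fintype ι] (n : ℕ) : ℝ :=
  (∑ k, weight Ω k * √(E.stratumVar Ω k)) ^ 2 / n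

end Environment

/-- What is recorded in one round: the chosen stratum, the query point, the observation. -/
abbrev Round (ι : Type) (d : ℕ) := ι × Point d × ℝ

/-- An online stratified-sampling algorithm, possibly randomized: in each round it chooses the index
of a stratum, with a law that depends on all that was recorded in the `t` rounds before. -/
structure Algorithm (ι : Type) [MeasurableSpace ι] (d : ℕ) where
  policy : (t : ℕ) → Kernel (Fin t → Round ι d) ι
  isMarkov_policy : ∀ t, IsMarkovKernel (policy t)

attribute [instance] Algorithm.isMarkov_policy

section Interaction

variable {ι : Type} [Fintype ι] [DecidableEq ι] [MeasurableSpace ι] [MeasurableSingletonClass ι]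
  {d : ℕ} (Ω : ι → Set (Point d)) (A : Algorithm ι d) (E : Environment d)

/-- One round, given the past: the algorithm chooses a stratum, which is then sampled uniformly. -/
def roundLaw (t : ℕ) : Kernel (Fin t → Round ι d) (Round ι d) :=
  A.policy t ⊗ₖ Kernel.prodMkLeft (Fin t → Round ι d) (E.sampleLaw Ω)

/-- The joint law of the first `t` rounds. -/
def historyLaw : (t : ℕ) → Measure (Fin t → Round ι d)
  | 0 => Measure.dirac Fin.elim0
  | t + 1 => (historyLaw t ⊗ₘ roundLaw Ω A E t).map
      fun p => Fin.snoc (α := fun _ => Round ι d) p.1 p.2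

/-- The number `T_{k,n}` of samples in stratum `k`. -/
def numSamples {n : ℕ} (h : Fin n → Round ι d) (k : ι) : ℕ :=
  (Finset.univ.filter fun t => (h t).1 = k).card

/-- The pseudo-risk `∑ k, w_k ^ 2 * σ_k ^ 2 / T_{k,n}`, with values in `[0, ∞]`: a stratum of positive
variance that has never been sampled contributes `∞`, one of variance zero contributes `0`. -/
def pseudoRisk {n : ℕ} (h : Fin n → Round ι d) : ENNReal :=
  ∑ k, ENNReal.ofReal (Environment.weight Ω k ^ 2 * E.stratumVar Ω k) / (numSamples h k : ENNReal)

/-- The expected pseudo-regret after `n` rounds: the expectation of the pseudo-risk minus the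
(deterministic and finite) pseudo-risk of the optimal oracle allocation. -/
def expectedPseudoRegret (n : ℕ) : EReal :=
  ((∫⁻ h, pseudoRisk Ω E h ∂(historyLaw Ω A E n) : ENNReal) : EReal) -
    ((E.oracleRisk Ω n : ℝ) : EReal)

end Interaction

end StratMC

end

/-! Rare noise is hard to detect, yet both ignoring it and guarding against it are costly. Half of
the strata, the set `H`, are Bernoulli of mean `1/2`; each other stratum has mean `p` or `0`,
according to a bit `θ k`. Put `a = √(p(1-p))/K`. The sum `S` of the weighted standard deviations
lies in `[1/6, 1/2]`, so the oracle gives a noisy stratum `a n / S ≥ 2 a n` samples and a noiseless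
one none. A stratum outside `H` on the wrong side of `a n / 2` samples costs at least `a / (72 n)`
(`oracleRisk_add_le_pseudoRisk`).

With mean `p`, a sample is `0` with probability `1 - p`, so `T` samples of a noisy stratum look
noiseless with probability `(1 - p)^T`. If `p a n / 2 ≤ 1/2`, this is at least `1/2` up to the
threshold, and the two values of `θ k` cannot both be judged well (`half_le_historyLaw`). Averaging
over `θ` yields an environment with at least `K/8` expected misjudgements
(`exists_card_le_sum_misjudgeProb`), hence regret at least `√(p(1-p)) / (576 n)`. The choice `p =
(K/n)^(2/3) / 2` respects the constraint and gives the rate. If `n < K`, an unsampled noisy stratum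
makes the regret infinite. -/

noncomputable section

namespace StratMC

/-! ### Bernoulli observations as mean plus standardized noise. -/

section Bernoulli

/-- The two-point law of a standardized Bernoulli variable of mean `q`; a fair sign when the
Bernoulli variable is deterministic. -/
def bernoulliNoise (q : ℝ) : Measure ℝ :=
  if q * (1 - q) = 0 then
    ENNReal.ofReal (1 / 2) • Measure.dirac 1 + ENNReal.ofReal (1 / 2) • Measure.dirac (-1)
  else
    ENNReal.ofReal q • Measure.dirac ((1 - q) / √(q * (1 - q))) +
      ENNReal.ofReal (1 - q) • Measure.dirac (-q / √(q * (1 - q)))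

/-- The law of a Bernoulli variable of mean `q`. -/
def bernoulliLaw (q : ℝ) : Measure ℝ :=
  ENNReal.ofReal q • Measure.dirac 1 + ENNReal.ofReal (1 - q) • Measure.dirac 0

lemma integral_twoPoint {a b : ℝ} (ha : 0 ≤ a) (hb : 0 ≤ b) (u v : ℝ) (g : ℝ → ℝ) :
    ∫ ε, g ε ∂(ENNReal.ofReal a • Measure.dirac u + ENNReal.ofReal b • Measure.dirac v) =
      a * g u + b * g v := by
  have h (c w : ℝ) : Integrable g (ENNReal.ofReal c • Measure.dirac w) :=
    (integrable_dirac (by simp)).smul_measure ENNReal.ofReal_ne_top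
  rw [integral_add_measure (h _ _) (h _ _), integral_smul_measure, integral_smul_measure,
    integral_dirac, integral_dirac, ENNReal.toReal_ofReal ha, ENNReal.toReal_ofReal hb]
  simp

variable {q : ℝ} (hq : q ∈ Set.Icc (0 : ℝ) 1)
include hq

lemma isProbabilityMeasure_bernoulliNoise : IsProbabilityMeasure (bernoulliNoise q) := by
  obtain ⟨h0, h1⟩ := hq
  constructor
  unfold bernoulliNoise
  split_ifs
  · simp only [Measure.add_apply, Measure.smul_apply, measure_univ, smul_eq_mul, mul_one]
    rw [← ENNReal.ofReal_add] <;> norm_num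
  · simp only [Measure.add_apply, Measure.smul_apply, measure_univ, smul_eq_mul, mul_one]
    rw [← ENNReal.ofReal_add h0 (by linarith)]
    norm_num

lemma sqrt_ne_zero_of_var_ne_zero (h : q * (1 - q) ≠ 0) : √(q * (1 - q)) ≠ 0 :=
  Real.sqrt_ne_zero'.2 (lt_of_le_of_ne (mul_nonneg hq.1 (by linarith [hq.2])) h.symm)

lemma integral_bernoulliNoise : ∫ ε, ε ∂(bernoulliNoise q) = 0 := by
  obtain ⟨h0, h1⟩ := hq
  unfold bernoulliNoise
  split_ifs with h
  · rw [integral_twoPoint (by norm_num) (by norm_num)]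
    norm_num
  · rw [integral_twoPoint h0 (by linarith)]
    ring

lemma integral_sq_bernoulliNoise : ∫ ε, ε ^ 2 ∂(bernoulliNoise q) = 1 := by
  have hs := sqrt_ne_zero_of_var_ne_zero hq
  obtain ⟨h0, h1⟩ := hq
  unfold bernoulliNoise
  split_ifs with h
  · rw [integral_twoPoint (by norm_num) (by norm_num)]
    norm_num
  · rw [integral_twoPoint h0 (by linarith), div_pow, div_pow,
      Real.sq_sqrt (mul_nonneg h0 (by linarith))]
    have h2 : q ≠ 0 := left_ne_zero_of_mul h
    have h3 : 1 - q ≠ 0 := right_ne_zero_of_mul h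
    field_simp
    ring

lemma map_bernoulliNoise :
    (bernoulliNoise q).map (fun ε => q + √(q * (1 - q)) * ε) = bernoulliLaw q := by
  have hs := sqrt_ne_zero_of_var_ne_zero hq
  have hm : Measurable fun ε : ℝ => q + √(q * (1 - q)) * ε := by fun_prop
  unfold bernoulliNoise bernoulliLaw
  split_ifs with h
  · rw [Measure.map_add _ _ hm, Measure.map_smul, Measure.map_smul, Measure.map_dirac' hm,
      Measure.map_dirac' hm, h, Real.sqrt_zero]
    simp only [zero_mul, add_zero]
    rw [← add_smul, ← ENNReal.ofReal_add (by norm_num) (by norm_num), add_halves,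
      ENNReal.ofReal_one, one_smul]
    -- The noise is multiplied by `0`, leaving the Dirac mass at `q`, which is `0` or `1`.
    rcases mul_eq_zero.1 h with h | h
    · simp [h]
    · obtain rfl : q = 1 := by linarith
      simp
  · have hs := hs h
    rw [Measure.map_add _ _ hm, Measure.map_smul, Measure.map_smul, Measure.map_dirac' hm,
      Measure.map_dirac' hm]
    congr 3 <;> field_simp <;> ring

lemma ae_bernoulliNoise :
    ∀ᵐ ε ∂(bernoulliNoise q), q + √(q * (1 - q)) * ε = 0 ∨ q + √(q * (1 - q)) * ε = 1 := by
  have hm : Measurable fun ε : ℝ => q + √(q * (1 - q)) * ε := by fun_prop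
  have hS : MeasurableSet {y : ℝ | y = 0 ∨ y = 1} :=
    (measurableSet_singleton 0).union (measurableSet_singleton 1)
  refine (ae_map_iff hm.aemeasurable hS).1 ?_
  have h0 : ∀ᵐ y : ℝ ∂(Measure.dirac 0), y = 0 ∨ y = 1 := (ae_dirac_iff hS).2 (by simp)
  have h1 : ∀ᵐ y : ℝ ∂(Measure.dirac 1), y = 0 ∨ y = 1 := (ae_dirac_iff hS).2 (by simp)
  rw [map_bernoulliNoise hq, bernoulliLaw, ae_add_measure_iff]
  exact ⟨Measure.ae_smul_measure h1 _, Measure.ae_smul_measure h0 _⟩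

end Bernoulli

/-! ### Geometry of the grid. -/

section Grid

variable {d l : ℕ}

/-- The index of the cell of the grid that contains `x`. -/
def cellIndex [NeZero l] (x : Point d) : Fin d → Fin l := fun i =>
  -- The minimum puts the right end point `1` in the last cell and makes the index total outside the
  -- cube.
  ⟨min ⌊(l : ℝ) * x i⌋₊ (l - 1), by have := NeZero.pos l; omega⟩

lemma measurable_cellIndex [NeZero l] : Measurable (cellIndex : Point d → Fin d → Fin l) := by
  refine measurable_pi_lambda _ fun i => ?_
  have h : Measurable fun x : Point d => ⌊(l : ℝ) * x i⌋₊ :=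
    Nat.measurable_floor.comp (by fun_prop)
  exact (measurable_from_top
    (f := fun m : ℕ => (⟨min m (l - 1), by have := NeZero.pos l; omega⟩ : Fin l))).comp h

lemma cellIndex_eq_of_mem [NeZero l] {k : Fin d → Fin l} {x : Point d}
    (hx : x ∈ gridStratum d l k) : cellIndex x = k := by
  have hl : (0 : ℝ) < l := by exact_mod_cast NeZero.pos l
  funext i
  obtain ⟨h1, h2⟩ := hx i
  ext
  have hk := (k i).2
  rw [div_le_iff₀ hl] at h1
  rcases h2 with h2 | ⟨h2, h3⟩
  · rw [lt_div_iff₀ hl] at h2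
    have : ⌊(l : ℝ) * x i⌋₊ = (k i : ℕ) := by
      rw [Nat.floor_eq_iff (by rw [mul_comm]; exact le_trans (by positivity) h1)]
      constructor <;> linarith
    simp only [cellIndex, this]
    omega
  · simp only [cellIndex, h3, mul_one, Nat.floor_natCast]
    omega

lemma gridStratum_eq_pi (k : Fin d → Fin l) :
    gridStratum d l k = Set.univ.pi fun i => {y : ℝ | ((k i : ℕ) : ℝ) / l ≤ y ∧
      (y < (((k i : ℕ) : ℝ) + 1) / l ∨ ((k i : ℕ) + 1 = l ∧ y = 1))} := by
  ext x
  simp [gridStratum]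

lemma axis_eq [NeZero l] (j : Fin l) :
    {y : ℝ | ((j : ℕ) : ℝ) / l ≤ y ∧ (y < (((j : ℕ) : ℝ) + 1) / l ∨ ((j : ℕ) + 1 = l ∧ y = 1))} =
      if (j : ℕ) + 1 = l then Set.Icc (((j : ℕ) : ℝ) / l) ((((j : ℕ) : ℝ) + 1) / l)
      else Set.Ico (((j : ℕ) : ℝ) / l) ((((j : ℕ) : ℝ) + 1) / l) := by
  have hl : (l : ℝ) ≠ 0 := by exact_mod_cast NeZero.ne l
  ext y
  split_ifs with h
  · have h1 : (((j : ℕ) : ℝ) + 1) / l = 1 := by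
      rw [div_eq_one_iff_eq hl]
      exact_mod_cast h
    simp [h, h1, le_iff_lt_or_eq (b := (1 : ℝ))]
  · simp [h]

lemma measurableSet_gridStratum [NeZero l] (k : Fin d → Fin l) :
    MeasurableSet (gridStratum d l k) := by
  rw [gridStratum_eq_pi]
  refine MeasurableSet.univ_pi fun i => ?_
  rw [axis_eq]
  split_ifs <;> measurability

lemma volume_gridStratum [NeZero l] (k : Fin d → Fin l) :
    volume (gridStratum d l k) = ENNReal.ofReal (1 / l) ^ d := by
  have h (i : Fin d) : volume {y : ℝ | ((k i : ℕ) : ℝ) / l ≤ y ∧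
      (y < (((k i : ℕ) : ℝ) + 1) / l ∨ ((k i : ℕ) + 1 = l ∧ y = 1))} =
      ENNReal.ofReal (1 / l) := by
    rw [axis_eq]
    split_ifs
    · rw [Real.volume_Icc]
      congr 1
      ring
    · rw [Real.volume_Ico]
      congr 1
      ring
  rw [gridStratum_eq_pi, volume_pi_pi]
  simp [h]

lemma weight_gridStratum [NeZero l] (k : Fin d → Fin l) :
    Environment.weight (gridStratum d l) k = 1 / ((l ^ d : ℕ) : ℝ) := by
  rw [Environment.weight, Measure.real, volume_gridStratum, ENNReal.toReal_pow,
    ENNReal.toReal_ofReal (by positivity)]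
  simp

lemma isProbabilityMeasure_cond_gridStratum [NeZero l] (k : Fin d → Fin l) :
    IsProbabilityMeasure (cond volume (gridStratum d l k)) := by
  have hl : l ≠ 0 := NeZero.ne l
  refine cond_isProbabilityMeasure_of_finite ?_ ?_ <;> rw [volume_gridStratum]
  · exact pow_ne_zero _ (by simpa using hl)
  · exact ENNReal.pow_ne_top ENNReal.ofReal_ne_top

end Grid

/-! ### Environments that are Bernoulli with constant mean on each stratum. -/

section BernoulliEnv

variable {d l : ℕ} [NeZero l] (q : (Fin d → Fin l) → ℝ) (hq : ∀ k, q k ∈ Set.Icc (0 : ℝ) 1)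

/-- The environment whose observations in the stratum `k` of the grid are Bernoulli variables of
mean `q k`. -/
def bernoulliEnv : Environment d where
  f x := q (cellIndex x)
  s x := √(q (cellIndex x) * (1 - q (cellIndex x)))
  noise := (Kernel.ofFunOfCountable fun k => bernoulliNoise (q k)).comap cellIndex
    measurable_cellIndex
  measurable_f := (measurable_of_countable q).comp measurable_cellIndex
  measurable_s :=
    (measurable_of_countable fun k => √(q k * (1 - q k))).comp measurable_cellIndex
  memLp_f := by
    have : IsFiniteMeasure (volume.restrict (cube d)) :=
      ⟨by simpa [cube] using (isCompact_Icc (a := (0 : Point d)) (b := 1)).measure_lt_top⟩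
    refine MemLp.of_bound
      ((measurable_of_countable q).comp measurable_cellIndex).aestronglyMeasurable 1 ?_
    refine Filter.Eventually.of_forall fun x => ?_
    rw [Real.norm_eq_abs, abs_of_nonneg (hq _).1]
    exact (hq _).2
  memLp_s := by
    have : IsFiniteMeasure (volume.restrict (cube d)) :=
      ⟨by simpa [cube] using (isCompact_Icc (a := (0 : Point d)) (b := 1)).measure_lt_top⟩
    refine MemLp.of_bound ((measurable_of_countable fun k => √(q k * (1 - q k))).comp
      measurable_cellIndex).aestronglyMeasurable 1 ?_
    refine Filter.Eventually.of_forall fun x => ?_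
    rw [Real.norm_eq_abs, abs_of_nonneg (Real.sqrt_nonneg _)]
    refine Real.sqrt_le_one.2 ?_
    nlinarith [(hq (cellIndex x)).1, (hq (cellIndex x)).2]
  s_nonneg _ _ := Real.sqrt_nonneg _
  isMarkov_noise := by
    have : IsMarkovKernel (Kernel.ofFunOfCountable fun k => bernoulliNoise (q k)) :=
      ⟨fun k => isProbabilityMeasure_bernoulliNoise (hq k)⟩
    infer_instance
  noise_mean x _ := integral_bernoulliNoise (hq (cellIndex x))
  noise_variance x _ := integral_sq_bernoulliNoise (hq (cellIndex x))

lemma isBinary_bernoulliEnv : (bernoulliEnv q hq).IsBinary := fun x _ =>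
  ae_bernoulliNoise (hq (cellIndex x))

lemma observe_bernoulliEnv (x : Point d) :
    (bernoulliEnv q hq).observe x = bernoulliLaw (q (cellIndex x)) := by
  have hm : Measurable fun p : Point d × ℝ =>
      (bernoulliEnv q hq).f p.1 + (bernoulliEnv q hq).s p.1 * p.2 :=
    ((bernoulliEnv q hq).measurable_f.comp measurable_fst).add
      (((bernoulliEnv q hq).measurable_s.comp measurable_fst).mul measurable_snd)
  rw [Environment.observe, Kernel.map_apply _ hm, Kernel.prod_apply, Kernel.id_apply,
    Measure.dirac_prod, Measure.map_map hm (by fun_prop)]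
  exact map_bernoulliNoise (hq (cellIndex x))

lemma isMarkovKernel_observe (E : Environment d) : IsMarkovKernel E.observe :=
  Kernel.IsMarkovKernel.map _ <| (E.measurable_f.comp measurable_fst).add
    ((E.measurable_s.comp measurable_fst).mul measurable_snd)

instance isMarkovKernel_sampleLaw (E : Environment d) :
    IsMarkovKernel (E.sampleLaw (gridStratum d l)) := by
  refine ⟨fun k => ?_⟩
  have := isMarkovKernel_observe E
  have := isProbabilityMeasure_cond_gridStratum k
  change IsProbabilityMeasure ((cond volume (gridStratum d l k)) ⊗ₘ E.observe)
  infer_instance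

/-- Almost every sampled point lies in the stratum, where the observation law is constant. In this
form, laws with different means are compared through their two coefficients. -/
lemma lintegral_sampleLaw_bernoulliEnv (k : Fin d → Fin l) {g : Point d × ℝ → ENNReal}
    (hg : Measurable g) :
    ∫⁻ z, g z ∂((bernoulliEnv q hq).sampleLaw (gridStratum d l) k) =
      ∫⁻ x, (ENNReal.ofReal (q k) * g (x, 1) + ENNReal.ofReal (1 - q k) * g (x, 0))
        ∂(cond volume (gridStratum d l k)) := by
  have := isMarkovKernel_observe (bernoulliEnv q hq)
  have := isProbabilityMeasure_cond_gridStratum k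
  change ∫⁻ z, g z ∂((cond volume (gridStratum d l k)) ⊗ₘ (bernoulliEnv q hq).observe) = _
  rw [Measure.lintegral_compProd hg]
  refine lintegral_congr_ae ?_
  filter_upwards [ae_cond_mem (measurableSet_gridStratum k)] with x hx
  rw [observe_bernoulliEnv, cellIndex_eq_of_mem hx, bernoulliLaw, lintegral_add_measure,
    lintegral_smul_measure, lintegral_smul_measure, lintegral_dirac, lintegral_dirac]
  simp

lemma weight_gridStratum_pos (k : Fin d → Fin l) :
    0 < Environment.weight (gridStratum d l) k := by
  have := NeZero.pos l
  rw [weight_gridStratum]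
  positivity

lemma stratumMean_bernoulliEnv (k : Fin d → Fin l) :
    (bernoulliEnv q hq).stratumMean (gridStratum d l) k = q k := by
  have h : ∫ x in gridStratum d l k, (bernoulliEnv q hq).f x =
      ∫ _ in gridStratum d l k, q k :=
    setIntegral_congr_fun (measurableSet_gridStratum k) fun x hx =>
      congrArg q (cellIndex_eq_of_mem hx)
  rw [Environment.stratumMean, h, setIntegral_const, smul_eq_mul, ← Environment.weight,
    inv_mul_cancel_left₀ (weight_gridStratum_pos k).ne']

lemma stratumVar_bernoulliEnv (k : Fin d → Fin l) :
    (bernoulliEnv q hq).stratumVar (gridStratum d l) k = q k * (1 - q k) := by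
  have h : ∫ x in gridStratum d l k, ∫ ε, ((bernoulliEnv q hq).f x + (bernoulliEnv q hq).s x * ε -
      (bernoulliEnv q hq).stratumMean (gridStratum d l) k) ^ 2 ∂((bernoulliEnv q hq).noise x) =
      ∫ _ in gridStratum d l k, q k * (1 - q k) := by
    refine setIntegral_congr_fun (measurableSet_gridStratum k) fun x hx => ?_
    rw [stratumMean_bernoulliEnv]
    change ∫ ε, (q (cellIndex x) + √(q (cellIndex x) * (1 - q (cellIndex x))) * ε - q k) ^ 2
      ∂(bernoulliNoise (q (cellIndex x))) = _
    rw [cellIndex_eq_of_mem hx]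
    simp only [add_sub_cancel_left, mul_pow]
    rw [integral_const_mul, integral_sq_bernoulliNoise (hq k), mul_one,
      Real.sq_sqrt (mul_nonneg (hq k).1 (by linarith [(hq k).2]))]
  rw [Environment.stratumVar, h, setIntegral_const, smul_eq_mul, ← Environment.weight,
    inv_mul_cancel_left₀ (weight_gridStratum_pos k).ne']

end BernoulliEnv

/-! ### Histories and change of measure. -/

section History

lemma measurable_snoc {α : Type*} [MeasurableSpace α] (t : ℕ) :
    Measurable fun p : (Fin t → α) × α => Fin.snoc (α := fun _ => α) p.1 p.2 := by
  refine measurable_pi_lambda _ fun i => ?_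
  induction i using Fin.lastCases with
  | last => simpa using measurable_snd
  | cast i =>
    simp only [Fin.snoc_castSucc]
    exact (measurable_pi_apply i).comp measurable_fst

lemma measurable_numSamples {ι : Type} [DecidableEq ι] [MeasurableSpace ι]
    [MeasurableSingletonClass ι] {d : ℕ} (n : ℕ) (k : ι) :
    Measurable fun h : Fin n → Round ι d => numSamples h k := by
  simp only [numSamples, Finset.card_filter]
  refine Finset.measurable_sum _ fun t _ => Measurable.ite ?_ measurable_const measurable_const
  exact (measurable_fst.comp (measurable_pi_apply t)) (measurableSet_singleton k)

lemma numSamples_snoc {ι : Type} [DecidableEq ι] {d t : ℕ} (h : Fin t → Round ι d)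
    (r : Round ι d) (k : ι) :
    numSamples (Fin.snoc (α := fun _ => Round ι d) h r) k =
      numSamples h k + if r.1 = k then 1 else 0 := by
  simp only [numSamples, Finset.card_filter, Fin.sum_univ_castSucc, Fin.snoc_castSucc,
    Fin.snoc_last]

lemma sum_numSamples {ι : Type} [Fintype ι] [DecidableEq ι] {d n : ℕ} (h : Fin n → Round ι d) :
    ∑ k, numSamples h k = n := by
  simp only [numSamples]
  rw [← Finset.card_eq_sum_card_fiberwise (fun _ _ => Finset.mem_coe.2 (Finset.mem_univ _)),
    Finset.card_univ, Fintype.card_fin]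

variable {ι : Type} [Fintype ι] [MeasurableSpace ι] [MeasurableSingletonClass ι]
  {d : ℕ} (Ω : ι → Set (Point d)) (A : Algorithm ι d) (E E' : Environment d)

lemma lintegral_roundLaw [IsMarkovKernel (E.sampleLaw Ω)] (t : ℕ) (h : Fin t → Round ι d)
    {g : Round ι d → ENNReal} (hg : Measurable g) :
    ∫⁻ r, g r ∂(roundLaw Ω A E t h) =
      ∫⁻ j, ∫⁻ z, g (j, z) ∂(E.sampleLaw Ω j) ∂(A.policy t h) := by
  rw [roundLaw, Kernel.lintegral_compProd _ _ _ hg]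
  rfl

instance isMarkovKernel_roundLaw [IsMarkovKernel (E.sampleLaw Ω)] (t : ℕ) :
    IsMarkovKernel (roundLaw Ω A E t) := by
  unfold roundLaw
  infer_instance

instance isProbabilityMeasure_historyLaw [IsMarkovKernel (E.sampleLaw Ω)] (t : ℕ) :
    IsProbabilityMeasure (historyLaw Ω A E t) := by
  induction t with
  | zero => exact Measure.dirac.isProbabilityMeasure
  | succ t ih => exact Measure.isProbabilityMeasure_map (measurable_snoc t).aemeasurable

lemma lintegral_historyLaw_succ [IsMarkovKernel (E.sampleLaw Ω)] (t : ℕ)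
    {g : (Fin (t + 1) → Round ι d) → ENNReal} (hg : Measurable g) :
    ∫⁻ h, g h ∂(historyLaw Ω A E (t + 1)) =
      ∫⁻ h, ∫⁻ j, ∫⁻ z, g (Fin.snoc (α := fun _ => Round ι d) h (j, z))
        ∂(E.sampleLaw Ω j) ∂(A.policy t h) ∂(historyLaw Ω A E t) := by
  have hgs : Measurable fun p : (Fin t → Round ι d) × Round ι d =>
      g (Fin.snoc (α := fun _ => Round ι d) p.1 p.2) := hg.comp (measurable_snoc t)
  rw [historyLaw, lintegral_map hg (measurable_snoc t), Measure.lintegral_compProd hgs]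
  exact lintegral_congr fun h => lintegral_roundLaw Ω A E t h (hgs.comp measurable_prodMk_left)

variable [DecidableEq ι]

/-- If a single sample in each stratum has a larger law under `E'` than under `E`, up to a factor
`c` in the stratum `k`, then so have the histories, up to a factor `c` for each sample in `k`. -/
lemma lintegral_historyLaw_le [IsMarkovKernel (E.sampleLaw Ω)] [IsMarkovKernel (E'.sampleLaw Ω)]
    (k : ι) (c : ENNReal)
    (hc : ∀ j, (if j = k then c else 1) • E.sampleLaw Ω j ≤ E'.sampleLaw Ω j) (n : ℕ) :
    ∀ {g : (Fin n → Round ι d) → ENNReal}, Measurable g →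
      ∫⁻ h, c ^ numSamples h k * g h ∂(historyLaw Ω A E n) ≤
        ∫⁻ h, g h ∂(historyLaw Ω A E' n) := by
  induction n with
  | zero =>
    intro g hg
    simp [numSamples, historyLaw]
  | succ t ih =>
    intro g hg
    have hgs : Measurable fun p : (Fin t → Round ι d) × Round ι d =>
        g (Fin.snoc (α := fun _ => Round ι d) p.1 p.2) := hg.comp (measurable_snoc t)
    have hcg : Measurable fun h : Fin (t + 1) → Round ι d => c ^ numSamples h k * g h :=
      ((measurable_of_countable (fun m : ℕ => c ^ m)).comp (measurable_numSamples _ k)).mul hg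
    have hG : Measurable fun h => ∫⁻ j, ∫⁻ z, g (Fin.snoc (α := fun _ => Round ι d) h (j, z))
        ∂(E'.sampleLaw Ω j) ∂(A.policy t h) := by
      have h1 := Measurable.lintegral_kernel_prod_right' (κ := roundLaw Ω A E' t) hgs
      refine (congrArg Measurable (funext fun h => ?_)).mp h1
      exact lintegral_roundLaw Ω A E' t h (hgs.comp measurable_prodMk_left)
    rw [lintegral_historyLaw_succ Ω A E' t hg, lintegral_historyLaw_succ Ω A E t hcg]
    -- The induction hypothesis is applied to `g` with its last round already integrated under `E'`;
    -- what remains is the domination for that single round.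
    refine le_trans (lintegral_mono fun h => ?_) (ih hG)
    rw [← lintegral_const_mul _ (measurable_of_countable _)]
    refine lintegral_mono fun j => ?_
    have hz : Measurable fun z => g (Fin.snoc (α := fun _ => Round ι d) h (j, z)) :=
      hgs.comp (measurable_prodMk_left.comp measurable_prodMk_left)
    have hnum (z : Point d × ℝ) : numSamples (Fin.snoc (α := fun _ => Round ι d) h (j, z)) k =
        numSamples h k + if j = k then 1 else 0 := numSamples_snoc h (j, z) k
    simp only [hnum, pow_add, mul_assoc]
    rw [lintegral_const_mul _ (hz.const_mul _), lintegral_const_mul _ hz]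
    refine mul_le_mul_right ?_ _
    have h2 := lintegral_mono' (hc j) (le_refl fun z =>
      g (Fin.snoc (α := fun _ => Round ι d) h (j, z)))
    rw [lintegral_smul_measure] at h2
    refine le_trans (le_of_eq ?_) h2
    split_ifs <;> simp

/-- A stratum that is rarely sampled in `E` is also rarely sampled in `E'`. -/
lemma half_le_historyLaw [IsMarkovKernel (E.sampleLaw Ω)] [IsMarkovKernel (E'.sampleLaw Ω)]
    (k : ι) (p : ℝ) (hp0 : 0 ≤ p) (hp1 : p ≤ 1)
    (hc : ∀ j, (if j = k then ENNReal.ofReal (1 - p) else 1) • E.sampleLaw Ω j ≤ E'.sampleLaw Ω j)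
    (n : ℕ) (τ : ℝ) (hτ : p * τ ≤ 1 / 2) :
    2⁻¹ ≤ (historyLaw Ω A E n) {h : Fin n → Round ι d | τ < numSamples h k} +
      (historyLaw Ω A E' n) {h : Fin n → Round ι d | (numSamples h k : ℝ) ≤ τ} := by
  set B := {h : Fin n → Round ι d | (numSamples h k : ℝ) ≤ τ} with hB
  have hBm : MeasurableSet B :=
    (measurable_numSamples n k) (show MeasurableSet {m : ℕ | (m : ℝ) ≤ τ} from trivial)
  have hBc : {h : Fin n → Round ι d | τ < numSamples h k} = Bᶜ := by
    ext h
    simp [hB]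
  have hle : 2⁻¹ * historyLaw Ω A E n B ≤ historyLaw Ω A E' n B := by
    have h1 := lintegral_historyLaw_le Ω A E E' k _ hc n (measurable_one.indicator hBm)
    rw [lintegral_indicator_one hBm] at h1
    refine le_trans ?_ h1
    rw [← lintegral_indicator_one hBm, ← lintegral_const_mul _ (measurable_one.indicator hBm)]
    refine lintegral_mono fun h => ?_
    by_cases hh : h ∈ B
    · simp only [Set.indicator_of_mem hh, Pi.one_apply, mul_one]
      rw [← ENNReal.ofReal_pow (by linarith), ← ENNReal.ofReal_ofNat,
        ← ENNReal.ofReal_inv_of_pos (by norm_num)]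
      refine ENNReal.ofReal_le_ofReal ?_
      -- Bernoulli's inequality: on `B`, `(1 - p)^T ≥ 1 - p T ≥ 1 - p τ ≥ 1/2`.
      have h2 := one_add_mul_le_pow (a := -p) (by linarith) (numSamples h k)
      have h3 : p * (numSamples h k : ℝ) ≤ p * τ := mul_le_mul_of_nonneg_left hh hp0
      rw [← sub_eq_add_neg] at h2
      norm_num
      linarith
    · simp [Set.indicator_of_notMem hh]
  have htot : historyLaw Ω A E n Bᶜ + historyLaw Ω A E n B = 1 := by
    rw [add_comm, measure_add_measure_compl hBm, measure_univ]
  rw [hBc]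
  calc (2⁻¹ : ENNReal) = 2⁻¹ * historyLaw Ω A E n Bᶜ + 2⁻¹ * historyLaw Ω A E n B := by
        rw [← mul_add, htot, mul_one]
    _ ≤ 1 * historyLaw Ω A E n Bᶜ + historyLaw Ω A E' n B := by
        gcongr
        exact ENNReal.inv_le_one.2 (by norm_num)
    _ = _ := by rw [one_mul]

end History

/-! ### Comparison of a noiseless and a noisy stratum. -/

section TwoPoint

variable {d l : ℕ} [NeZero l]

/-- In the stratum `k` the first environment only produces `0`, which the second produces with
probability `1 - q' k`; the other strata agree. -/
lemma smul_sampleLaw_bernoulliEnv_le {q q' : (Fin d → Fin l) → ℝ}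
    (hq : ∀ k, q k ∈ Set.Icc (0 : ℝ) 1) (hq' : ∀ k, q' k ∈ Set.Icc (0 : ℝ) 1)
    (k : Fin d → Fin l) (h0 : q k = 0) (hne : ∀ j, j ≠ k → q j = q' j) (j : Fin d → Fin l) :
    (if j = k then ENNReal.ofReal (1 - q' k) else 1) •
        (bernoulliEnv q hq).sampleLaw (gridStratum d l) j ≤
      (bernoulliEnv q' hq').sampleLaw (gridStratum d l) j := by
  refine Measure.le_iff.2 fun s hs => ?_
  have hm : Measurable (s.indicator (1 : Point d × ℝ → ENNReal)) := measurable_one.indicator hs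
  rw [Measure.smul_apply, ← lintegral_indicator_one hs, ← lintegral_indicator_one hs,
    lintegral_sampleLaw_bernoulliEnv _ _ _ hm, lintegral_sampleLaw_bernoulliEnv _ _ _ hm]
  split_ifs with hj
  · subst hj
    rw [smul_eq_mul, h0, ← lintegral_const_mul' _ _ ENNReal.ofReal_ne_top]
    refine lintegral_mono fun x => ?_
    simp
  · rw [one_smul, hne j hj]

end TwoPoint

/-! ### Excess of the pseudo-risk over the oracle risk. -/

section PseudoRisk

/-- For `T ≠ 0`, `a²/T = 2aλ - λ²T + (a - λT)²/T`: a tangent bound whose remainder is at least `b`.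
For `T = 0` the right side is `∞` if `a > 0`, and `0` if `a = 0`, whence the hypothesis `h0`. -/
lemma ofReal_le_ofReal_sq_div {a lam b : ℝ} {T : ℕ} (ha : 0 ≤ a)
    (hT : T ≠ 0 → b * T ≤ (a - lam * T) ^ 2) (h0 : T = 0 → a = 0 → b ≤ 0) :
    ENNReal.ofReal (2 * a * lam - lam ^ 2 * T + b) ≤ ENNReal.ofReal (a ^ 2) / T := by
  by_cases hT0 : T = 0
  · subst hT0
    rcases ha.eq_or_lt with ha | ha
    · have := h0 rfl ha.symm
      simp [← ha, this]
    · have h1 : ENNReal.ofReal (a ^ 2) ≠ 0 := (ENNReal.ofReal_pos.2 (pow_pos ha 2)).ne'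
      simp only [Nat.cast_zero]
      rw [ENNReal.div_zero h1]
      exact le_top
  · have hpos : (0 : ℝ) < T := by exact_mod_cast Nat.pos_of_ne_zero hT0
    rw [← ENNReal.ofReal_natCast T, ← ENNReal.ofReal_div_of_pos hpos]
    refine ENNReal.ofReal_le_ofReal ?_
    rw [le_div_iff₀ hpos]
    linarith [hT hT0]

/-- Lower bound on the pseudo-risk of an allocation `T` by the oracle risk, with a gain `b k` for
each stratum `k` whose number of samples is far from the optimal one. -/
lemma ofReal_oracle_add_le {ι : Type} [Fintype ι] {a b : ι → ℝ} {T : ι → ℕ} {n : ℕ}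
    (hn : n ≠ 0) (hsum : ∑ k, T k = n) (ha : ∀ k, 0 ≤ a k)
    (hT : ∀ k, T k ≠ 0 → b k * T k ≤ (a k - (∑ j, a j) / n * T k) ^ 2)
    (h0 : ∀ k, T k = 0 → a k = 0 → b k ≤ 0) :
    ENNReal.ofReal ((∑ k, a k) ^ 2 / n + ∑ k, b k) ≤
      ∑ k, ENNReal.ofReal (a k ^ 2) / (T k : ENNReal) := by
  set S := ∑ j, a j
  have hn' : (n : ℝ) ≠ 0 := by exact_mod_cast hn
  have hs : (∑ k, (T k : ℝ)) = n := by exact_mod_cast hsum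
  -- With the common slope `λ = S / n`, the tangent terms add up to `2S²/n - S²/n`, the oracle risk.
  have h : S ^ 2 / n + ∑ k, b k =
      ∑ k, (2 * a k * (S / n) - (S / n) ^ 2 * T k + b k) := by
    rw [Finset.sum_add_distrib, Finset.sum_sub_distrib, ← Finset.mul_sum, hs, ← Finset.sum_mul,
      ← Finset.mul_sum]
    change _ = 2 * S * (S / n) - _ + _
    field_simp
    ring
  rw [h]
  refine le_trans ?_ (Finset.sum_le_sum fun k _ => ofReal_le_ofReal_sq_div (ha k) (hT k) (h0 k))
  exact Finset.le_sum_of_subadditive _ ENNReal.ofReal_zero.le (fun _ _ => ENNReal.ofReal_add_le) _ _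

/-- A stratum of standard deviation `a` is undersampled. -/
lemma gain_mul_le_of_undersampled {a S n T : ℝ} (ha : 0 ≤ a) (hn : 0 < n)
    (hS : S ≤ 1 / 2) (hT0 : 0 ≤ T) (hT : T ≤ a * n / 2) :
    a / (72 * n) * T ≤ (a - S / n * T) ^ 2 := by
  have h1 : S / n * T ≤ a / 4 := by
    calc S / n * T ≤ (1 / 2) / n * (a * n / 2) := by gcongr
      _ = a / 4 := by field_simp; ring
  have h2 : a / (72 * n) * T ≤ a ^ 2 / 144 := by
    calc a / (72 * n) * T ≤ a / (72 * n) * (a * n / 2) := by gcongr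
      _ = a ^ 2 / 144 := by field_simp; ring
  nlinarith [mul_nonneg ha (by linarith : 0 ≤ a / 4 - S / n * T)]

/-- A stratum of standard deviation `0` is oversampled. -/
lemma gain_mul_le_of_oversampled {a S n T : ℝ} (hn : 0 < n) (hS : 1 / 6 ≤ S)
    (hT0 : 0 ≤ T) (hT : a * n / 2 ≤ T) :
    a / (72 * n) * T ≤ (0 - S / n * T) ^ 2 := by
  -- The constant `72 = 6² · 2` combines `S ≥ 1/6` with the threshold `a n / 2`.
  have h1 : a / (72 * n) ≤ (1 / 6 / n) ^ 2 * T := by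
    calc a / (72 * n) = (1 / 6 / n) ^ 2 * (a * n / 2) := by field_simp; ring
      _ ≤ _ := by gcongr
  calc a / (72 * n) * T ≤ (1 / 6 / n) ^ 2 * T * T := by gcongr
    _ ≤ (S / n) ^ 2 * T * T := by gcongr
    _ = _ := by ring

lemma le_expectedPseudoRegret {d l : ℕ} (A : Algorithm (Fin d → Fin l) d) {E : Environment d}
    {n : ℕ} {c : ℝ} (hc : 0 ≤ c) (ho : 0 ≤ E.oracleRisk (gridStratum d l) n)
    (h : ENNReal.ofReal (E.oracleRisk (gridStratum d l) n) + ENNReal.ofReal c ≤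
      ∫⁻ h, pseudoRisk (gridStratum d l) E h ∂(historyLaw (gridStratum d l) A E n)) :
    (c : EReal) ≤ expectedPseudoRegret (gridStratum d l) A E n := by
  rw [expectedPseudoRegret, EReal.le_sub_iff_add_le (by simp) (by simp), ← EReal.coe_add]
  rw [← ENNReal.ofReal_add ho hc] at h
  refine le_trans (le_of_eq ?_) (EReal.coe_ennreal_le_coe_ennreal_iff.2 h)
  rw [EReal.coe_ennreal_ofReal, max_eq_left (add_nonneg ho hc), add_comm]

end PseudoRisk

/-! ### The hard environments and averaging over them. -/

section HardFamily

variable {ι : Type} [DecidableEq ι]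

/-- Bernoulli means of the hard environments: `1 / 2` on `H`, and outside of `H` either `p` or `0`
according to `θ`. -/
def hardMeans (H : Finset ι) (p : ℝ) (θ : ι → Bool) (k : ι) : ℝ :=
  if k ∈ H then 1 / 2 else if θ k then p else 0

lemma hardMeans_mem_Icc (H : Finset ι) {p : ℝ} (hp0 : 0 ≤ p) (hp1 : p ≤ 1) (θ : ι → Bool) (k : ι) :
    hardMeans H p θ k ∈ Set.Icc (0 : ℝ) 1 := by
  unfold hardMeans
  split_ifs <;> constructor <;> norm_num <;> assumption

/-- The histories that misjudge the stratum `k`: too few samples if it is noisy, too many if not. -/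
def misjudged {d n : ℕ} (τ : ℝ) (θ : ι → Bool) (k : ι) : Set (Fin n → Round ι d) :=
  {h | if θ k then (numSamples h k : ℝ) ≤ τ else τ < numSamples h k}

lemma measurableSet_misjudged [MeasurableSpace ι] [MeasurableSingletonClass ι] {d n : ℕ} (τ : ℝ)
    (θ : ι → Bool) (k : ι) : MeasurableSet (misjudged τ θ k : Set (Fin n → Round ι d)) :=
  (measurable_numSamples n k)
    (show MeasurableSet {m : ℕ | if θ k then (m : ℝ) ≤ τ else τ < m} from trivial)

variable {d l : ℕ} [NeZero l] (A : Algorithm (Fin d → Fin l) d) (H : Finset (Fin d → Fin l))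
  {p : ℝ} (hp0 : 0 ≤ p) (hp1 : p ≤ 1) (θ : (Fin d → Fin l) → Bool)

/-- The environment with means `hardMeans`. -/
abbrev hardEnv : Environment d :=
  bernoulliEnv (hardMeans H p θ) (hardMeans_mem_Icc H hp0 hp1 θ)

/-- The probability of misjudging the stratum `k` in the environment `hardEnv`. -/
def misjudgeProb (n : ℕ) (τ : ℝ) (k : Fin d → Fin l) : ENNReal :=
  historyLaw (gridStratum d l) A (hardEnv H hp0 hp1 θ) n (misjudged τ θ k)

lemma half_le_misjudgeProb_add {n : ℕ} {τ : ℝ} (hτ : p * τ ≤ 1 / 2) {k : Fin d → Fin l}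
    (hk : k ∉ H) {θ θ' : (Fin d → Fin l) → Bool} (h0 : θ k = false) (h1 : θ' k = true)
    (hne : ∀ j, j ≠ k → θ j = θ' j) :
    2⁻¹ ≤ misjudgeProb A H hp0 hp1 θ n τ k + misjudgeProb A H hp0 hp1 θ' n τ k := by
  have hp : hardMeans H p θ' k = p := by simp [hardMeans, hk, h1]
  have hc := smul_sampleLaw_bernoulliEnv_le (hardMeans_mem_Icc H hp0 hp1 θ)
    (hardMeans_mem_Icc H hp0 hp1 θ') k (by simp [hardMeans, hk, h0])
    (fun j hj => by simp [hardMeans, hne j hj])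
  rw [hp] at hc
  have h := half_le_historyLaw (gridStratum d l) A (hardEnv H hp0 hp1 θ) (hardEnv H hp0 hp1 θ')
    k p hp0 hp1 hc n τ hτ
  simpa [misjudgeProb, misjudged, h0, h1] using h

/-- Flipping the bit at `k` pairs the environments; the two probabilities of a pair sum to at least
`1/2`, so their average over all `θ` is at least `1/4`. -/
lemma card_le_sum_misjudgeProb {n : ℕ} {τ : ℝ} (hτ : p * τ ≤ 1 / 2) {k : Fin d → Fin l}
    (hk : k ∉ H) :
    ∑ _θ : (Fin d → Fin l) → Bool, (4⁻¹ : ENNReal) ≤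
      ∑ θ, misjudgeProb A H hp0 hp1 θ n τ k := by
  set F := fun θ => misjudgeProb A H hp0 hp1 θ n τ k
  let flip (θ : (Fin d → Fin l) → Bool) := Function.update θ k (!θ k)
  have hinv : Function.Involutive flip := fun θ => by simp [flip]
  have hpair (θ) : 2⁻¹ ≤ F θ + F (flip θ) := by
    cases hθ : θ k
    · exact half_le_misjudgeProb_add A H hp0 hp1 hτ hk hθ (by simp [flip, hθ])
        fun j hj => by simp [flip, hj]
    · rw [add_comm]
      exact half_le_misjudgeProb_add A H hp0 hp1 hτ hk (by simp [flip, hθ]) hθ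
        fun j hj => by simp [flip, hj]
  have hsum : ∑ _θ : (Fin d → Fin l) → Bool, (2⁻¹ : ENNReal) ≤ 2 * ∑ θ, F θ := by
    refine (Finset.sum_le_sum fun θ _ => hpair θ).trans ?_
    rw [Finset.sum_add_distrib, two_mul]
    exact le_of_eq (congrArg _ (Equiv.sum_comp hinv.toPerm F))
  have h4 : (4⁻¹ : ENNReal) = 2⁻¹ * 2⁻¹ := by
    rw [← ENNReal.mul_inv (by simp) (by simp)]
    norm_num
  calc ∑ _θ : (Fin d → Fin l) → Bool, (4⁻¹ : ENNReal)
      = 2⁻¹ * ∑ _θ : (Fin d → Fin l) → Bool, (2⁻¹ : ENNReal) := by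
        rw [Finset.mul_sum, h4]
    _ ≤ 2⁻¹ * (2 * ∑ θ, F θ) := by gcongr
    _ = ∑ θ, F θ := by
        rw [← mul_assoc, ENNReal.inv_mul_cancel (by simp) (by simp), one_mul]

/-- If every `θ` failed, summing over `θ` and exchanging the sums would contradict the average bound
for each stratum outside `H`. -/
lemma exists_card_le_sum_misjudgeProb {n : ℕ} {τ : ℝ} (hτ : p * τ ≤ 1 / 2) :
    ∃ θ, (Hᶜ.card : ENNReal) * 4⁻¹ ≤ ∑ k ∈ Hᶜ, misjudgeProb A H hp0 hp1 θ n τ k := by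
  by_contra! hlt
  refine (ENNReal.sum_lt_sum_of_nonempty Finset.univ_nonempty fun θ _ => hlt θ).not_ge ?_
  rw [Finset.sum_comm]
  simp only [← nsmul_eq_mul, ← Finset.sum_const (4⁻¹ : ENNReal) (s := Hᶜ)]
  rw [Finset.sum_comm]
  exact Finset.sum_le_sum fun k hk =>
    card_le_sum_misjudgeProb A H hp0 hp1 hτ (Finset.mem_compl.1 hk)

/-- The standard deviation of the stratum `k`, multiplied by its weight. -/
def hardStd (p : ℝ) (k : Fin d → Fin l) : ℝ :=
  Environment.weight (gridStratum d l) k * √(hardMeans H p θ k * (1 - hardMeans H p θ k))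

lemma hardStd_of_mem {k : Fin d → Fin l} (hk : k ∈ H) :
    hardStd H θ p k = 1 / ((l ^ d : ℕ) : ℝ) * (1 / 2) := by
  rw [hardStd, weight_gridStratum, hardMeans, if_pos hk,
    show (1 / 2 : ℝ) * (1 - 1 / 2) = (1 / 2) ^ 2 by norm_num, Real.sqrt_sq (by norm_num)]

lemma hardStd_of_notMem {k : Fin d → Fin l} (hk : k ∉ H) :
    hardStd H θ p k = if θ k then 1 / ((l ^ d : ℕ) : ℝ) * √(p * (1 - p)) else 0 := by
  rw [hardStd, weight_gridStratum, hardMeans, if_neg hk]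
  split_ifs <;> simp

lemma hardStd_nonneg (k : Fin d → Fin l) : 0 ≤ hardStd H θ p k :=
  mul_nonneg (weight_gridStratum_pos k).le (Real.sqrt_nonneg _)

lemma sum_hardStd_le : ∑ k, hardStd H θ p k ≤ 1 / 2 := by
  have hl : (l : ℝ) ≠ 0 := by exact_mod_cast NeZero.ne l
  calc ∑ k, hardStd H θ p k ≤ ∑ _k : Fin d → Fin l, 1 / ((l ^ d : ℕ) : ℝ) * (1 / 2) := by
        refine Finset.sum_le_sum fun k _ => ?_
        rw [hardStd, weight_gridStratum]
        refine mul_le_mul_of_nonneg_left ?_ (by positivity)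
        rw [Real.sqrt_le_left (by norm_num)]
        nlinarith [sq_nonneg (hardMeans H p θ k - 1 / 2)]
    _ = 1 / 2 := by
        simp
        field_simp

/-- The strata in `H` alone suffice: at least `K/3` of them, each contributing `1/(2K)`. -/
lemma le_sum_hardStd (hH : l ^ d ≤ 3 * H.card) : 1 / 6 ≤ ∑ k, hardStd H θ p k := by
  have hK : (0 : ℝ) < ((l ^ d : ℕ) : ℝ) := by exact_mod_cast pow_pos (NeZero.pos l) d
  have hH' : ((l ^ d : ℕ) : ℝ) ≤ 3 * H.card := by exact_mod_cast hH
  calc (1 / 6 : ℝ) ≤ H.card * (1 / ((l ^ d : ℕ) : ℝ) * (1 / 2)) := by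
        rw [one_div_mul_one_div, mul_one_div, le_div_iff₀ (by positivity)]
        linarith
    _ = ∑ k ∈ H, hardStd H θ p k := by
        rw [Finset.sum_congr rfl fun k hk => hardStd_of_mem H θ hk, Finset.sum_const, nsmul_eq_mul]
    _ ≤ ∑ k, hardStd H θ p k :=
        Finset.sum_le_sum_of_subset_of_nonneg (Finset.subset_univ _)
          fun k _ _ => hardStd_nonneg H θ k

lemma oracleRisk_hardEnv (n : ℕ) :
    (hardEnv H hp0 hp1 θ).oracleRisk (gridStratum d l) n = (∑ k, hardStd H θ p k) ^ 2 / n := by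
  simp only [Environment.oracleRisk, stratumVar_bernoulliEnv, hardStd]

lemma pseudoRisk_hardEnv {n : ℕ} (h : Fin n → Round (Fin d → Fin l) d) :
    pseudoRisk (gridStratum d l) (hardEnv H hp0 hp1 θ) h =
      ∑ k, ENNReal.ofReal (hardStd H θ p k ^ 2) / (numSamples h k : ENNReal) := by
  unfold pseudoRisk
  refine Finset.sum_congr rfl fun k _ => ?_
  have hk := hardMeans_mem_Icc H hp0 hp1 θ k
  rw [stratumVar_bernoulliEnv, hardStd, mul_pow,
    Real.sq_sqrt (mul_nonneg hk.1 (by linarith [hk.2]))]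

lemma oracleRisk_add_le_pseudoRisk (hH : l ^ d ≤ 3 * H.card) {n : ℕ} (hn : n ≠ 0) {a : ℝ}
    (ha : a = 1 / ((l ^ d : ℕ) : ℝ) * √(p * (1 - p))) (h : Fin n → Round (Fin d → Fin l) d) :
    ENNReal.ofReal ((hardEnv H hp0 hp1 θ).oracleRisk (gridStratum d l) n) +
        ∑ k ∈ Hᶜ, ENNReal.ofReal (a / (72 * n)) *
          (misjudged (a * n / 2) θ k).indicator 1 h ≤
      pseudoRisk (gridStratum d l) (hardEnv H hp0 hp1 θ) h := by
  classical
  have hn' : (0 : ℝ) < n := by exact_mod_cast Nat.pos_of_ne_zero hn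
  have ha0 : 0 ≤ a := by rw [ha]; positivity
  have hS1 := sum_hardStd_le (p := p) H θ
  have hS0 := le_sum_hardStd (p := p) H θ hH
  let b (k : Fin d → Fin l) : ℝ :=
    if k ∉ H ∧ h ∈ misjudged (a * n / 2) θ k then a / (72 * n) else 0
  have hb (k) : 0 ≤ b k := by
    unfold b
    split_ifs <;> positivity
  have key := ofReal_oracle_add_le (a := hardStd H θ p) (b := b) hn (sum_numSamples h)
    (hardStd_nonneg H θ) (fun k _ => ?_) (fun k hk hk0 => ?_)
  · rw [pseudoRisk_hardEnv, oracleRisk_hardEnv]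
    refine le_trans (le_of_eq ?_) key
    rw [ENNReal.ofReal_add (by positivity) (Finset.sum_nonneg fun k _ => hb k),
      ENNReal.ofReal_sum_of_nonneg fun k _ => hb k]
    congr 1
    rw [← Finset.sum_subset (Finset.subset_univ Hᶜ)]
    · refine Finset.sum_congr rfl fun k hk => ?_
      have hk := Finset.mem_compl.1 hk
      by_cases hm : h ∈ misjudged (a * n / 2) θ k <;> simp [b, hk, hm]
    · intro k _ hk
      have hk : k ∈ H := by simpa using hk
      simp [b, hk]
  · unfold b
    split_ifs with hm
    · obtain ⟨hkH, hm⟩ := hm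
      rw [hardStd_of_notMem H θ hkH, ← ha]
      cases hθ : θ k
      · have hm : a * n / 2 < numSamples h k := by simpa [misjudged, hθ] using hm
        exact gain_mul_le_of_oversampled hn' hS0 (by positivity) hm.le
      · have hm : (numSamples h k : ℝ) ≤ a * n / 2 := by simpa [misjudged, hθ] using hm
        exact gain_mul_le_of_undersampled ha0 hn' hS1 (by positivity) hm
    · rw [zero_mul]
      positivity
  · unfold b
    split_ifs with hm
    · obtain ⟨hkH, hm⟩ := hm
      rw [hardStd_of_notMem H θ hkH, ← ha] at hk0
      -- Zero samples never exceed the threshold, so an unsampled noiseless stratum is not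
      -- misjudged; in the noisy case `a = 0` and the gain vanishes.
      cases hθ : θ k
      · have hm : a * n / 2 < numSamples h k := by simpa [misjudged, hθ] using hm
        rw [hk, Nat.cast_zero] at hm
        exact absurd hm (not_lt.2 (by positivity))
      · simp only [hθ, if_true] at hk0
        simp [hk0]
    · exact le_rfl

/-- Among the hard environments, one has a large pseudo-regret. -/
lemma exists_hardEnv_le_expectedPseudoRegret (hH : l ^ d ≤ 3 * H.card)
    (hHc : l ^ d ≤ 2 * Hᶜ.card) {n : ℕ} (hn : n ≠ 0)
    (hτ : p * (1 / ((l ^ d : ℕ) : ℝ) * √(p * (1 - p)) * n / 2) ≤ 1 / 2) :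
    ∃ θ, ((√(p * (1 - p)) / (576 * n) : ℝ) : EReal) ≤
      expectedPseudoRegret (gridStratum d l) A (hardEnv H hp0 hp1 θ) n := by
  obtain ⟨a, ha⟩ : ∃ a, a = 1 / ((l ^ d : ℕ) : ℝ) * √(p * (1 - p)) := ⟨_, rfl⟩
  have hK : (0 : ℝ) < ((l ^ d : ℕ) : ℝ) := by exact_mod_cast pow_pos (NeZero.pos l) d
  have hn' : (0 : ℝ) < n := by exact_mod_cast Nat.pos_of_ne_zero hn
  have ha0 : 0 ≤ a := by rw [ha]; positivity
  rw [← ha] at hτ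
  obtain ⟨θ, hθ⟩ := exists_card_le_sum_misjudgeProb A H hp0 hp1 (n := n) hτ
  refine ⟨θ, le_expectedPseudoRegret A (by positivity) ?_ ?_⟩
  · rw [oracleRisk_hardEnv]
    positivity
  refine le_trans ?_ (lintegral_mono (oracleRisk_add_le_pseudoRisk H hp0 hp1 θ hH hn ha))
  have hmeas (k) : Measurable
      ((misjudged (a * n / 2) θ k).indicator (1 : (Fin n → Round (Fin d → Fin l) d) → ENNReal)) :=
    measurable_one.indicator (measurableSet_misjudged _ θ k)
  rw [lintegral_add_left measurable_const, lintegral_const, measure_univ, mul_one,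
    lintegral_finsetSum _ fun k _ => (hmeas k).const_mul _]
  gcongr
  simp only [lintegral_const_mul _ (hmeas _),
    lintegral_indicator_one (measurableSet_misjudged _ θ _)]
  rw [← Finset.mul_sum]
  refine le_trans ?_ (mul_le_mul_right hθ _)
  rw [← ENNReal.ofReal_natCast, ← ENNReal.ofReal_ofNat 4,
    ← ENNReal.ofReal_inv_of_pos (by norm_num), ← ENNReal.ofReal_mul (by positivity),
    ← ENNReal.ofReal_mul (by positivity)]
  refine ENNReal.ofReal_le_ofReal ?_
  have hHc' : ((l ^ d : ℕ) : ℝ) ≤ 2 * Hᶜ.card := by exact_mod_cast hHc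
  -- At least `K/2` strata lie outside `H`, each misjudged with average probability at least `1/4`,
  -- and `576 = 72 · 8`.
  calc √(p * (1 - p)) / (576 * n)
      = a / (72 * n) * (((l ^ d : ℕ) : ℝ) / 2 * 4⁻¹) := by
        rw [ha]
        field_simp
        ring
    _ ≤ _ := by
        gcongr
        · linarith

/-- With fewer samples than strata, the pseudo-regret is infinite as soon as all strata are
noisy. -/
lemma expectedPseudoRegret_eq_top {n : ℕ} (hn : n < l ^ d) :
    expectedPseudoRegret (gridStratum d l) A
      (bernoulliEnv (l := l) (fun _ => 1 / 2) fun _ => by norm_num) n = ⊤ := by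
  have h (h : Fin n → Round (Fin d → Fin l) d) : pseudoRisk (gridStratum d l)
      (bernoulliEnv (l := l) (fun _ => 1 / 2) fun _ => by norm_num) h = ⊤ := by
    obtain ⟨k, hk⟩ : ∃ k, numSamples h k = 0 := by
      by_contra! hne
      have h1 : ∑ _k : Fin d → Fin l, 1 ≤ ∑ k, numSamples h k :=
        Finset.sum_le_sum fun k _ => Nat.one_le_iff_ne_zero.2 (hne k)
      rw [sum_numSamples] at h1
      simp at h1
      omega
    refine ENNReal.sum_eq_top.2 ⟨k, Finset.mem_univ k, ?_⟩
    rw [hk, Nat.cast_zero, stratumVar_bernoulliEnv]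
    refine ENNReal.div_zero (ne_of_gt (ENNReal.ofReal_pos.2 ?_))
    have := weight_gridStratum_pos k
    positivity
  rw [expectedPseudoRegret]
  simp only [h]
  simp

end HardFamily

/-! ### Choice of the parameters. -/

section Rate

/-- The choice of the mean `r ^ 2 / 2` of the rarely noisy strata, where `r ^ 3 = K / n`. -/
lemma rate_bounds {K n r : ℝ} (hK : 0 < K) (hn : 0 < n) (hr0 : 0 ≤ r) (hr1 : r ≤ 1)
    (hr : r ^ 3 = K / n) :
    r ^ 2 / 2 * (1 / K * √(r ^ 2 / 2 * (1 - r ^ 2 / 2)) * n / 2) ≤ 1 / 2 ∧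
      r / 2 ≤ √(r ^ 2 / 2 * (1 - r ^ 2 / 2)) := by
  have hr2 : r ^ 2 ≤ 1 := pow_le_one₀ hr0 hr1
  constructor
  · have h1 : √(r ^ 2 / 2 * (1 - r ^ 2 / 2)) ≤ r := by
      rw [Real.sqrt_le_left hr0]
      nlinarith [sq_nonneg r]
    calc r ^ 2 / 2 * (1 / K * √(r ^ 2 / 2 * (1 - r ^ 2 / 2)) * n / 2)
        ≤ r ^ 2 / 2 * (1 / K * r * n / 2) := by gcongr
      _ = r ^ 3 * n / K / 4 := by ring
      _ ≤ 1 / 2 := by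
        rw [hr, div_mul_cancel₀ _ hn.ne', div_self hK.ne']
        norm_num
  -- Since `r² ≤ 1`, the factor `1 - r²/2` is at least `1/2`.
  · refine Real.le_sqrt_of_sq_le ?_
    nlinarith [sq_nonneg r]

lemma rpow_rate_eq {K n : ℝ} (hK : 0 < K) (hn : 0 < n) :
    K ^ (1 / 3 : ℝ) / n ^ (4 / 3 : ℝ) = (K / n) ^ (1 / 3 : ℝ) / n := by
  rw [Real.div_rpow hK.le hn.le, div_div, show (4 / 3 : ℝ) = 1 / 3 + 1 by norm_num,
    Real.rpow_add hn, Real.rpow_one]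

/-- Every algorithm has a large pseudo-regret in some environment with binary observations. -/
theorem exists_isBinary_le_expectedPseudoRegret {d l n : ℕ} (hK : 2 ≤ l ^ d) (hn : 1 ≤ n)
    (A : Algorithm (Fin d → Fin l) d) :
    ∃ E : {E : Environment d // E.IsBinary},
      ((1 / 1152 * ((l ^ d : ℕ) : ℝ) ^ (1 / 3 : ℝ) / (n : ℝ) ^ (4 / 3 : ℝ) : ℝ) : EReal) ≤
        expectedPseudoRegret (gridStratum d l) A E.1 n := by
  have hd : d ≠ 0 := by
    rintro rfl
    simp at hK
  have : NeZero l := ⟨by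
    rintro rfl
    simp [hd] at hK⟩
  -- The case `n < K` is treated apart, as `r ≤ 1` requires `K ≤ n`.
  rcases lt_or_ge n (l ^ d) with hnK | hnK
  · exact ⟨⟨bernoulliEnv (l := l) (fun _ => 1 / 2) fun _ => by norm_num,
      isBinary_bernoulliEnv _ _⟩,
      le_top.trans_eq (expectedPseudoRegret_eq_top A hnK).symm⟩
  have hcard : (Finset.univ : Finset (Fin d → Fin l)).card = l ^ d := by simp
  -- Of size `⌊K/2⌋`: as `K ≥ 2`, this is at least `K/3` (equality at `K = 3`), and the complement
  -- has at least `K/2` elements.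
  obtain ⟨H, -, hH⟩ := Finset.exists_subset_card_eq (hcard.symm ▸ Nat.div_le_self (l ^ d) 2)
  rw [hcard] at hH
  have hHc := H.card_add_card_compl
  rw [← Finset.card_univ, hcard] at hHc
  have hK0 : (0 : ℝ) < ((l ^ d : ℕ) : ℝ) := by exact_mod_cast (by omega : 0 < l ^ d)
  have hn0 : (0 : ℝ) < n := by exact_mod_cast hn
  obtain ⟨r, hr⟩ : ∃ r, r = (((l ^ d : ℕ) : ℝ) / n) ^ (1 / 3 : ℝ) := ⟨_, rfl⟩
  have hr0 : 0 ≤ r := by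
    rw [hr]
    positivity
  have hr1 : r ≤ 1 := by
    rw [hr]
    refine Real.rpow_le_one (by positivity) ((div_le_one hn0).2 ?_) (by norm_num)
    exact_mod_cast hnK
  have hr3 : r ^ 3 = ((l ^ d : ℕ) : ℝ) / n := by
    rw [hr, ← Real.rpow_mul_natCast (by positivity)]
    norm_num
  obtain ⟨hτ, hlow⟩ := rate_bounds hK0 hn0 hr0 hr1 hr3
  have hp0 : 0 ≤ r ^ 2 / 2 := by positivity
  have hp1 : r ^ 2 / 2 ≤ 1 := by nlinarith
  obtain ⟨θ, hθ⟩ := exists_hardEnv_le_expectedPseudoRegret A H hp0 hp1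
    (by omega) (by omega) (by omega) hτ
  refine ⟨⟨hardEnv H hp0 hp1 θ, isBinary_bernoulliEnv _ _⟩,
    le_trans (EReal.coe_le_coe_iff.2 ?_) hθ⟩
  rw [mul_div_assoc, rpow_rate_eq hK0 hn0, ← hr]
  calc 1 / 1152 * (r / n) = r / 2 / (576 * n) := by ring
    _ ≤ _ := by gcongr

end Rate

end StratMC

end

theorem mainTheorem1 :
    ∃ C : ℝ, 0 < C ∧ ∀ d l K n : ℕ, K = l ^ d → 2 ≤ K → 1 ≤ n →
      ((C * (K : ℝ) ^ (1 / 3 : ℝ) / (n : ℝ) ^ (4 / 3 : ℝ) : ℝ) : EReal) ≤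
          (⨅ A : StratMC.Algorithm (Fin d → Fin l) d, ⨆ E : StratMC.Environment d,
            StratMC.expectedPseudoRegret (StratMC.gridStratum d l) A E n) ∧
      ((C * (K : ℝ) ^ (1 / 3 : ℝ) / (n : ℝ) ^ (4 / 3 : ℝ) : ℝ) : EReal) ≤
          (⨅ A : StratMC.Algorithm (Fin d → Fin l) d,
            ⨆ E : {E : StratMC.Environment d // E.IsBinary},
              StratMC.expectedPseudoRegret (StratMC.gridStratum d l) A E.1 n) := by
  refine ⟨1 / 1152, by norm_num, ?_⟩
  rintro d l _ n rfl hK hn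
  have h := StratMC.exists_isBinary_le_expectedPseudoRegret (d := d) (l := l) hK hn
  constructor
  · refine le_iInf fun A => ?_
    obtain ⟨E, hE⟩ := h A
    exact le_iSup_of_le E.1 hE
  · refine le_iInf fun A => ?_
    obtain ⟨E, hE⟩ := h A
    exact le_iSup_of_le E hE
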